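/- Let $n\ge 2$, let $F_{n+1}$ be a free group with basis $a_0,a_1,\dots,a_n$, and let $F_n=\langle a_1,\dots,a_n\rangle\le F_{n+1}$. For $w\in F_n$ let $R_w\in\mathrm{Aut}(F_{n+1})$ be the automorphism with $R_w(a_0)=a_0w$ and $R_w(a_i)=a_i$ for $1\le i\le n$. Suppose that $w$ lies in a free factor of $F_n$ of rank $n-2$, that is, there are subgroups $H,K\le F_n$ such that $F_n$ is the internal free product $H*K$, $H$ is free of rank $n-2$, and $w\in H$. Let $X$ be a complete CAT$(0)$ space on which $\mathrm{Aut}(F_{n+1})$ acts by semisimple isometries, i.e. every $\gamma\in\mathrm{Aut}(F_{n+1})$ acts as an isometry of $X$ for which the infimum $\inf\{d(x,\gamma x)\mid x\in X\}$ is attained at some point of $X$. Then $R_w$ fixes a point of $X$: there is $x\in X$ with $R_w\cdot x=x$. -/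

import Mathlib

/-! ### CAT(0) spaces -/

/-- `c` restricts on `[0, dist x y]` to a geodesic from `x` to `y`: an isometric embedding of this
interval that starts at `x` and ends at `y`. (Values of `c` outside the interval are irrelevant.) -/
structure IsGeodesicPath {X : Type*} [MetricSpace X] (c : ℝ → X) (x y : X) : Prop where
  source : c 0 = x
  target : c (dist x y) = y
  dist_eq : ∀ s ∈ Set.Icc 0 (dist x y), ∀ t ∈ Set.Icc 0 (dist x y), dist (c s) (c t) = |s - t|

/-- `S` is a geodesic segment with endpoints `x` and `y`: the image of a geodesic. -/
def IsGeodesicSegment {X : Type*} [MetricSpace X] (S : Set X) (x y : X) : Prop :=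
  ∃ c : ℝ → X, IsGeodesicPath c x y ∧ S = c '' Set.Icc 0 (dist x y)

/-- A CAT(0) space: a geodesic metric space in which every geodesic triangle is at least as thin
as its comparison triangle in the Euclidean plane. The triangle has vertices `v 0, v 1, v 2`, and
`S i` is its side from `v i` to `v (i + 1)` (indices modulo 3); `v'` are the vertices of a
comparison triangle and `p'`, `q'` the comparison points of `p ∈ S i`, `q ∈ S j`. -/
structure IsCAT0 (X : Type*) [MetricSpace X] : Prop where
  exists_geodesic : ∀ x y : X, ∃ c : ℝ → X, IsGeodesicPath c x y
  thin : ∀ (v : Fin 3 → X) (S : Fin 3 → Set X),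
    (∀ i, IsGeodesicSegment (S i) (v i) (v (i + 1))) →
    ∀ v' : Fin 3 → EuclideanSpace ℝ (Fin 2), (∀ i j, dist (v' i) (v' j) = dist (v i) (v j)) →
    ∀ (i j : Fin 3), ∀ p ∈ S i, ∀ q ∈ S j,
    ∀ p' ∈ segment ℝ (v' i) (v' (i + 1)), ∀ q' ∈ segment ℝ (v' j) (v' (j + 1)),
    dist (v' i) p' = dist (v i) p → dist (v' j) q' = dist (v j) q →
    dist p q ≤ dist p' q'

/-! ### Semisimple isometries -/

/-- The translation length `‖γ‖ = inf {d(x, γ x) | x ∈ X}`. -/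
noncomputable def translationLength {X : Type*} [MetricSpace X] (γ : X → X) : ℝ :=
  ⨅ x : X, dist x (γ x)

/-- `Min(γ)`, the set of points where the infimum defining the translation length is attained. -/
def minSet {X : Type*} [MetricSpace X] (γ : X → X) : Set X :=
  {x | dist x (γ x) = translationLength γ}

/-- The isometry `γ` is semisimple: `Min(γ)` is non-empty. -/
def IsSemisimpleIsometry {X : Type*} [MetricSpace X] (γ : X → X) : Prop :=
  Isometry γ ∧ (minSet γ).Nonempty

/-- The action of `G` on `X` is by semisimple isometries. -/
def ActsBySemisimpleIsometries (G X : Type*) [Group G] [MetricSpace X] [MulAction G X] : Prop :=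
  ∀ g : G, IsSemisimpleIsometry (fun x : X => g • x)

/-! ### Free factors -/

/-- The subgroup `H` of `G` is a free factor: `G` is the internal free product of `H` and some
subgroup `K`. -/
def IsFreeFactor {G : Type*} [Group G] (H : Subgroup G) : Prop :=
  ∃ K : Subgroup G, Function.Bijective (Monoid.Coprod.lift H.subtype K.subtype)

/-- The group `G` is free of rank `m`. -/
def IsFreeOfRank (G : Type*) [Group G] (m : ℕ) : Prop :=
  Nonempty (FreeGroupBasis (Fin m) G)

/-! ### The automorphisms `R_w` -/

section Transvection

variable {n : ℕ} {F : Type*} [Group F]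

/-- The subgroup `F_n = ⟨a_1, …, a_n⟩` of the free group `F_{n+1}` with basis `a_0, …, a_n`. -/
def tailSubgroup (a : FreeGroupBasis (Fin (n + 1)) F) : Subgroup F :=
  Subgroup.closure (Set.range fun i : Fin n => a i.succ)

/-- The endomorphism `a_0 ↦ a_0 w`, `a_i ↦ a_i` for `i > 0`. -/
noncomputable def transvectionHom (a : FreeGroupBasis (Fin (n + 1)) F) (w : F) : F →* F :=
  a.lift (Fin.cons (a 0 * w) fun i : Fin n => a i.succ)

theorem transvectionHom_zero (a : FreeGroupBasis (Fin (n + 1)) F) (w : F) :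
    transvectionHom a w (a 0) = a 0 * w := by
  simp [transvectionHom]

theorem transvectionHom_succ (a : FreeGroupBasis (Fin (n + 1)) F) (w : F) (i : Fin n) :
    transvectionHom a w (a i.succ) = a i.succ := by
  simp [transvectionHom]

theorem transvectionHom_of_mem (a : FreeGroupBasis (Fin (n + 1)) F) (w : F) {x : F}
    (hx : x ∈ tailSubgroup a) : transvectionHom a w x = x := by
  have h : tailSubgroup a ≤ (transvectionHom a w).eqLocus (MonoidHom.id F) := by
    refine (Subgroup.closure_le _).2 ?_
    rintro _ ⟨i, rfl⟩
    exact transvectionHom_succ a w i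
  exact h hx

theorem transvectionHom_comp (a : FreeGroupBasis (Fin (n + 1)) F) {v w : F}
    (hw : w ∈ tailSubgroup a) (hvw : v * w = 1) :
    (transvectionHom a v).comp (transvectionHom a w) = MonoidHom.id F := by
  refine a.ext_hom _ _ fun i => ?_
  refine Fin.cases ?_ (fun i => ?_) i
  · simp [transvectionHom_zero, transvectionHom_of_mem a v hw, mul_assoc, hvw]
  · simp [transvectionHom_succ]

/-- The automorphism `R_w` of `F_{n+1}`, for `w ∈ F_n`: it sends `a_0` to `a_0 w` and fixes
`a_1, …, a_n`. -/
noncomputable def rightTransvection (a : FreeGroupBasis (Fin (n + 1)) F) (w : tailSubgroup a) :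
    MulAut F :=
  MonoidHom.toMulEquiv (transvectionHom a (w : F)) (transvectionHom a (w : F)⁻¹)
    (transvectionHom_comp a w.2 (inv_mul_cancel _))
    (transvectionHom_comp a (inv_mem w.2) (mul_inv_cancel _))

end Transvection

/-! A semisimple isometry `γ` yields a real character `φ` of its centralizer that kills elliptic
elements and is nonzero at `γ` unless `γ` is elliptic (`IsCAT0.exists_additive_on_centralizer`): an
asymptotic quasi-inner product with the axis of `γ`. Commutators inside the centralizer are killed
too.

Pick a basis with three letters `x`, `y`, `z` absent from `w`, where `x` is `a 0`. Let `R`, `L` be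
the right and left transvections by `w` and `θ` the simultaneous conjugation of `x` and `y` by `w`,
so that `θ * (R_y * R_x) = L_y * L_x`. In the centralizer of `θ` the four transvections are
commutators, so `φ θ = 0` and `θ` is elliptic. In the centralizer of `R_x`, the elements `R_y`,
`L_y` (via `z`) and `L_x` (via `y`) are commutators and `θ` is elliptic, so the same relation leaves
`φ R_x = 0`. -/

/-! ### Comparison triangles and midpoints -/

theorem exists_comparison_triangle {X : Type*} [MetricSpace X] (v : Fin 3 → X) :
    ∃ v' : Fin 3 → EuclideanSpace ℝ (Fin 2), ∀ i j, dist (v' i) (v' j) = dist (v i) (v j) := by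
  obtain ⟨c, hc⟩ : ∃ c, dist (v 0) (v 1) = c := ⟨_, rfl⟩
  obtain ⟨b, hb⟩ : ∃ b, dist (v 0) (v 2) = b := ⟨_, rfl⟩
  obtain ⟨e, he⟩ : ∃ e, dist (v 1) (v 2) = e := ⟨_, rfl⟩
  have hc0 : 0 ≤ c := hc ▸ dist_nonneg
  have hb0 : 0 ≤ b := hb ▸ dist_nonneg
  have he0 : 0 ≤ e := he ▸ dist_nonneg
  have h1 : c ≤ b + e := by
    have := dist_triangle_right (v 0) (v 1) (v 2); rwa [hc, hb, he] at this
  have h2 : b ≤ c + e := by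
    have := dist_triangle (v 0) (v 1) (v 2); rwa [hc, hb, he] at this
  have h3 : e ≤ c + b := by
    have := dist_triangle_left (v 1) (v 2) (v 0); rwa [hc, hb, he] at this
  -- With two vertices at `(0, 0)` and `(c, 0)`, the third is `(s, t)`; `s` comes from the law of
  -- cosines unless `c = 0`.
  obtain ⟨s, t, hst, hst'⟩ : ∃ s t : ℝ, s ^ 2 + t ^ 2 = b ^ 2 ∧ (c - s) ^ 2 + t ^ 2 = e ^ 2 := by
    rcases hc0.eq_or_lt with h | h
    · have : b = e := by linarith
      exact ⟨0, b, by ring, by rw [← h, this]; ring⟩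
    · have hs : (2 * c) * ((b ^ 2 + c ^ 2 - e ^ 2) / (2 * c)) = b ^ 2 + c ^ 2 - e ^ 2 := by
        field_simp
      set s := (b ^ 2 + c ^ 2 - e ^ 2) / (2 * c) with hs_def
      have h4 : s ≤ b := by
        rw [hs_def, div_le_iff₀ (by positivity)]; nlinarith
      have h5 : -b ≤ s := by
        rw [hs_def, le_div_iff₀ (by positivity)]; nlinarith
      have h6 : Real.sqrt (b ^ 2 - s ^ 2) ^ 2 = b ^ 2 - s ^ 2 := Real.sq_sqrt (by nlinarith)
      exact ⟨s, Real.sqrt (b ^ 2 - s ^ 2), by rw [h6]; ring, by rw [h6]; linarith⟩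
  have k1 : dist (!₂[(0 : ℝ), 0]) !₂[c, 0] = c := by
    rw [EuclideanSpace.dist_eq]
    simp [Real.dist_eq, hc0, Real.sqrt_sq]
  have k2 : dist (!₂[(0 : ℝ), 0]) !₂[s, t] = b := by
    rw [EuclideanSpace.dist_eq]
    simp [Real.dist_eq, hst, hb0, Real.sqrt_sq]
  have k3 : dist (!₂[c, (0 : ℝ)]) !₂[s, t] = e := by
    rw [EuclideanSpace.dist_eq]
    simp [Real.dist_eq, hst', he0, Real.sqrt_sq]
  refine ⟨![!₂[0, 0], !₂[c, 0], !₂[s, t]], fun i j => ?_⟩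
  fin_cases i <;> fin_cases j <;>
    simp only [Fin.mk_one, Fin.zero_eta, Fin.reduceFinMk, Matrix.cons_val_zero,
      Matrix.cons_val_one, Matrix.cons_val, dist_self, hc, hb, he, k1, k2, k3,
      dist_comm (v 1) (v 0), dist_comm (v 2) (v 0), dist_comm (v 2) (v 1),
      dist_comm !₂[c, (0 : ℝ)] !₂[(0 : ℝ), 0], dist_comm !₂[s, t] !₂[(0 : ℝ), 0],
      dist_comm !₂[s, t] !₂[c, (0 : ℝ)]]

theorem IsGeodesicPath.isGeodesicSegment {X : Type*} [MetricSpace X] {c : ℝ → X} {x y : X}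
    (hc : IsGeodesicPath c x y) : IsGeodesicSegment (c '' Set.Icc 0 (dist x y)) x y :=
  ⟨c, hc, rfl⟩

/-- The `CN` inequality of Bruhat and Tits. -/
theorem IsCAT0.exists_midpoint {X : Type*} [MetricSpace X] (hX : IsCAT0 X) (x y : X) :
    ∃ m : X, ∀ z : X,
      dist z m ^ 2 ≤ dist z x ^ 2 / 2 + dist z y ^ 2 / 2 - dist x y ^ 2 / 4 := by
  obtain ⟨c, hc⟩ := hX.exists_geodesic x y
  have hd : 0 ≤ dist x y := dist_nonneg
  have hm : dist x y / 2 ∈ Set.Icc 0 (dist x y) := ⟨by linarith, by linarith⟩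
  refine ⟨c (dist x y / 2), fun z => ?_⟩
  obtain ⟨c₁, hc₁⟩ := hX.exists_geodesic y z
  obtain ⟨c₂, hc₂⟩ := hX.exists_geodesic z x
  obtain ⟨v', hv'⟩ := exists_comparison_triangle ![x, y, z]
  -- Thinness is applied to `z` as the initial point of side 2 and the midpoint of side 0.
  have key := hX.thin ![x, y, z]
    ![c '' Set.Icc 0 (dist x y), c₁ '' Set.Icc 0 (dist y z), c₂ '' Set.Icc 0 (dist z x)]
    (by
      intro i
      fin_cases i
      · exact hc.isGeodesicSegment
      · exact hc₁.isGeodesicSegment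
      · exact hc₂.isGeodesicSegment) v' hv' 2 0 z ⟨0, ⟨le_rfl, dist_nonneg⟩, hc₂.source⟩
    (c (dist x y / 2)) ⟨_, hm, rfl⟩ (v' 2) (left_mem_segment ..) (midpoint ℝ (v' 0) (v' 1))
    (midpoint_mem_segment ..) (by simp) (by
      have h1 := hv' 0 1
      have h2 := hc.dist_eq 0 ⟨le_rfl, hd⟩ _ hm
      rw [hc.source, zero_sub, abs_neg, abs_of_nonneg hm.1] at h2
      simp only [Matrix.cons_val_zero, Matrix.cons_val_one] at h1 ⊢
      rw [dist_left_midpoint, h1, h2, Real.norm_ofNat]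
      ring)
  have h := EuclideanGeometry.dist_sq_add_dist_sq_eq_two_mul_dist_midpoint_sq_add_half_dist_sq
    (v' 2) (v' 0) (v' 1)
  have h20 := hv' 2 0
  have h21 := hv' 2 1
  have h01 := hv' 0 1
  simp only [Matrix.cons_val_zero, Matrix.cons_val_one, Matrix.cons_val] at h20 h21 h01
  rw [h20, h21, h01] at h
  have := pow_le_pow_left₀ dist_nonneg key 2
  nlinarith
-- The quasi-inner product
open Filter Topology

/-- Twice the quasi-inner product of the "vectors" `a b` and `c d`. -/
def crossDist {X : Type*} [MetricSpace X] (a b c d : X) : ℝ :=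
  dist a d ^ 2 + dist b c ^ 2 - dist a c ^ 2 - dist b d ^ 2

section crossDist

variable {X : Type*} [MetricSpace X]

theorem crossDist_add_left (a b e c d : X) :
    crossDist a b c d + crossDist b e c d = crossDist a e c d := by
  unfold crossDist; ring

theorem crossDist_add_right (a b c d e : X) :
    crossDist a b c d + crossDist a b d e = crossDist a b c e := by
  unfold crossDist; ring

theorem crossDist_swap_left (a b c d : X) : crossDist b a c d = -crossDist a b c d := by
  unfold crossDist; ring

theorem crossDist_self_right (a b c : X) : crossDist a b c c = 0 := by
  unfold crossDist; ring

/-- A weak Cauchy–Schwarz inequality: apply `CN` at the midpoint of `b` and `c`, seen from `a` and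
from `d`. -/
theorem IsCAT0.crossDist_le (hX : IsCAT0 X) (a b c d : X) :
    crossDist a b c d ≤ dist a b ^ 2 + dist c d ^ 2 := by
  obtain ⟨m, hm⟩ := hX.exists_midpoint b c
  have h1 := hm a
  have h2 := hm d
  have h3 := pow_le_pow_left₀ dist_nonneg (dist_triangle_right a d m) 2
  have h4 := sq_nonneg (dist a m - dist d m)
  rw [dist_comm d b, dist_comm d c] at h2
  unfold crossDist
  nlinarith

theorem IsCAT0.abs_crossDist_le (hX : IsCAT0 X) (a b c d : X) :
    |crossDist a b c d| ≤ dist a b ^ 2 + dist c d ^ 2 := by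
  refine abs_le'.2 ⟨hX.crossDist_le a b c d, ?_⟩
  rw [← crossDist_swap_left, dist_comm a b]
  exact hX.crossDist_le b a c d

end crossDist

/-! ### Translation lengths and characters of centralizers -/

section Action

variable {G X : Type*} [Group G] [MetricSpace X] [MulAction G X]

theorem crossDist_smul [IsIsometricSMul G X] (g : G) (a b c d : X) :
    crossDist (g • a) (g • b) (g • c) (g • d) = crossDist a b c d := by
  simp [crossDist, dist_smul]

theorem translationLength_le (γ : X → X) (x : X) : translationLength γ ≤ dist x (γ x) :=
  ciInf_le ⟨0, by rintro _ ⟨y, rfl⟩; exact dist_nonneg⟩ x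

theorem dist_pow_smul_le [IsIsometricSMul G X] (γ : G) (x : X) (n : ℕ) :
    dist x (γ ^ n • x) ≤ n * dist x (γ • x) := by
  induction n with
  | zero => simp
  | succ n ih =>
    have h := dist_triangle x (γ ^ n • x) (γ ^ (n + 1) • x)
    have h' : dist (γ ^ n • x) (γ ^ (n + 1) • x) = dist x (γ • x) := by
      rw [pow_succ, mul_smul, dist_smul]
    push_cast
    linarith

/-- The midpoint `m` of `x` and `γ • x` is moved by at most half of `dist x (γ ^ 2 • x)`. -/
theorem IsCAT0.two_mul_translationLength_le [IsIsometricSMul G X] (hX : IsCAT0 X) (γ : G) (x : X) :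
    2 * translationLength (fun y : X => γ • y) ≤ dist x (γ ^ 2 • x) := by
  obtain ⟨m, hm⟩ := hX.exists_midpoint x (γ • x)
  have h0 : 0 ≤ translationLength (fun y : X => γ • y) := Real.iInf_nonneg fun _ => dist_nonneg
  have h1 := translationLength_le (fun y : X => γ • y) m
  have h2 := hm (γ⁻¹ • m)
  have h3 := hm (γ • x)
  have h4 := hm (γ ^ 2 • x)
  have e1 : dist (γ⁻¹ • m) m = dist m (γ • m) := by
    rw [← dist_smul γ, smul_inv_smul]
  have e2 : dist (γ⁻¹ • m) x = dist (γ • x) m := by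
    rw [← dist_smul γ, smul_inv_smul, dist_comm]
  have e3 : dist (γ⁻¹ • m) (γ • x) = dist (γ ^ 2 • x) m := by
    rw [← dist_smul γ, smul_inv_smul, dist_comm, pow_two, mul_smul]
  have e4 : dist (γ ^ 2 • x) (γ • x) = dist x (γ • x) := by
    rw [pow_two, mul_smul, dist_smul, dist_comm]
  rw [e1, e2, e3] at h2
  rw [dist_self, dist_comm (γ • x) x] at h3
  rw [e4, dist_comm _ x] at h4
  refine (pow_le_pow_iff_left₀ (by positivity) dist_nonneg two_ne_zero).1 ?_
  have := pow_le_pow_left₀ h0 h1 2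
  nlinarith

/-- Doubling gives the lower bound for exponents `2 ^ k`. For general `n`, go on to `2 ^ n ≥ n`: a
shortfall at `n` could not be made up by the remaining steps. -/
theorem IsCAT0.dist_pow_smul_eq [IsIsometricSMul G X] (hX : IsCAT0 X) {γ : G} {x : X}
    (hx : x ∈ minSet (fun y : X => γ • y)) (n : ℕ) :
    dist x (γ ^ n • x) = n * dist x (γ • x) := by
  have hpow : ∀ k : ℕ, ∀ y : X,
      2 ^ k * translationLength (fun y : X => γ • y) ≤ dist y (γ ^ 2 ^ k • y) := by
    intro k
    induction k with
    | zero => intro y; simpa using translationLength_le (fun y : X => γ • y) y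
    | succ k ih =>
      intro y
      have : Nonempty X := ⟨x⟩
      have h1 := le_ciInf ih
      have h2 := hX.two_mul_translationLength_le (γ ^ 2 ^ k) y
      rw [← pow_mul, ← pow_succ] at h2
      unfold translationLength at h2
      rw [pow_succ]
      unfold translationLength at h1 ⊢
      linarith
  have hx' : translationLength (fun y : X => γ • y) = dist x (γ • x) := hx.symm
  refine le_antisymm (dist_pow_smul_le γ x n) ?_
  have h1 := hpow n x
  rw [hx'] at h1
  have hn : n ≤ 2 ^ n := Nat.lt_two_pow_self.le
  have h2 := dist_triangle x (γ ^ n • x) (γ ^ 2 ^ n • x)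
  have h3 : dist (γ ^ n • x) (γ ^ 2 ^ n • x) ≤ ((2 ^ n - n : ℕ) : ℝ) * dist x (γ • x) := by
    obtain ⟨k, hk⟩ := Nat.exists_eq_add_of_le hn
    rw [hk, Nat.add_sub_cancel_left, pow_add, mul_smul, dist_smul]
    exact dist_pow_smul_le γ x k
  rw [Nat.cast_sub hn] at h3
  push_cast at h3
  linarith

theorem IsCAT0.abs_crossDist_pow_le [IsIsometricSMul G X] (hX : IsCAT0 X) (γ : G) (p q x : X)
    (n : ℕ) :
    |crossDist p q x (γ ^ n • x)| ≤ n * (dist p q ^ 2 + dist x (γ • x) ^ 2) := by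
  induction n with
  | zero => simp [crossDist_self_right]
  | succ n ih =>
    rw [← crossDist_add_right p q x (γ ^ n • x)]
    have h := hX.abs_crossDist_le p q (γ ^ n • x) (γ ^ (n + 1) • x)
    rw [pow_succ, mul_smul, dist_smul, ← mul_smul, ← pow_succ] at h
    have := abs_add_le (crossDist p q x (γ ^ n • x))
      (crossDist p q (γ ^ n • x) (γ ^ (n + 1) • x))
    push_cast
    linarith

/-- The bound does not depend on `n`, so the left side is negligible after division by `n`. -/
theorem IsCAT0.abs_crossDist_pow_sub_le [IsIsometricSMul G X] (hX : IsCAT0 X) {γ g : G}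
    (hg : Commute γ g) (p q x : X) (n : ℕ) :
    |crossDist (g • p) (g • q) x (γ ^ n • x) - crossDist p q x (γ ^ n • x)| ≤
      2 * (dist p q ^ 2 + dist x (g⁻¹ • x) ^ 2) := by
  have h1 : crossDist (g • p) (g • q) x (γ ^ n • x) =
      crossDist p q (g⁻¹ • x) (γ ^ n • g⁻¹ • x) := by
    rw [← crossDist_smul g⁻¹, inv_smul_smul, inv_smul_smul, ← mul_smul, ← mul_smul,
      (hg.inv_right.pow_left n).eq]
  have h2 : crossDist p q (g⁻¹ • x) (γ ^ n • g⁻¹ • x) - crossDist p q x (γ ^ n • x) =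
      -crossDist p q x (g⁻¹ • x) + crossDist p q (γ ^ n • x) (γ ^ n • g⁻¹ • x) := by
    unfold crossDist; ring
  rw [h1, h2]
  have h3 := hX.abs_crossDist_le p q x (g⁻¹ • x)
  have h4 := hX.abs_crossDist_le p q (γ ^ n • x) (γ ^ n • g⁻¹ • x)
  rw [dist_smul] at h4
  have h5 := abs_add_le (-crossDist p q x (g⁻¹ • x))
    (crossDist p q (γ ^ n • x) (γ ^ n • g⁻¹ • x))
  rw [abs_neg] at h5
  linarith

/-- A semisimple isometry `γ` gives rise to an additive real function on its centralizer which
vanishes on the elliptic elements and whose value at `γ` is zero only if `γ` is elliptic. -/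
theorem IsCAT0.exists_additive_on_centralizer [IsIsometricSMul G X] (hX : IsCAT0 X) (γ : G)
    (hγ : (minSet (fun y : X => γ • y)).Nonempty) :
    ∃ φ : G → ℝ, (∀ g h, Commute γ g → Commute γ h → φ (g * h) = φ g + φ h) ∧
      (∀ g, Commute γ g → (∃ y : X, g • y = y) → φ g = 0) ∧
      (φ γ = 0 → ∃ y : X, γ • y = y) := by
  obtain ⟨x, hx⟩ := hγ
  -- The quotients `f g n` are only known to be bounded; a nonprincipal ultrafilter provides limits
  -- that still add.
  let U : Ultrafilter ℕ := hyperfilter ℕ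
  have hU : (U : Filter ℕ) ≤ atTop := by
    rw [← Nat.cofinite_eq_atTop]; exact hyperfilter_le_cofinite
  let f : G → ℕ → ℝ := fun g n => crossDist x (g • x) x (γ ^ n • x) / n
  have hf : ∀ g, ∃ l, Tendsto (f g) U (𝓝 l) := by
    intro g
    set C := dist x (g • x) ^ 2 + dist x (γ • x) ^ 2 with hC
    have hmem : ∀ n, f g n ∈ Set.Icc (-C) C := by
      intro n
      rw [Set.mem_Icc, ← abs_le]
      have h1 := hX.abs_crossDist_pow_le γ x (g • x) x n
      simp only [f, abs_div, Nat.abs_cast]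
      exact div_le_of_le_mul₀ (by positivity) (by positivity) (by rw [mul_comm]; exact h1)
    obtain ⟨l, -, hl⟩ := isCompact_Icc.ultrafilter_le_nhds' (U.map (f g))
      (Ultrafilter.mem_map.2 (Filter.Eventually.of_forall hmem))
    exact ⟨l, hl⟩
  choose φ hφ using hf
  have hbdd : ∀ (u : ℕ → ℝ) (C : ℝ), (∀ n, |u n| ≤ C) →
      Tendsto (fun n : ℕ => u n / n) U (𝓝 0) := by
    intro u C hu
    refine Tendsto.mono_left ?_ hU
    refine squeeze_zero_norm (fun n => ?_) (tendsto_const_div_atTop_nhds_zero_nat C)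
    rw [norm_div, Real.norm_eq_abs, Real.norm_natCast]
    exact div_le_div_of_nonneg_right (hu n) (Nat.cast_nonneg n)
  refine ⟨φ, fun g h hg hh => ?_, fun g hg ⟨y, hy⟩ => ?_, fun h0 => ?_⟩
  · have h1 := hbdd _ _ (hX.abs_crossDist_pow_sub_le hg x (h • x) x)
    refine tendsto_nhds_unique (hφ (g * h)) ?_
    have h2 := ((hφ g).add (hφ h)).add h1
    rw [add_zero] at h2
    refine h2.congr fun n => ?_
    have := crossDist_add_left x (g • x) ((g * h) • x) x (γ ^ n • x)
    simp only [f]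
    rw [← this, mul_smul]
    ring
  · have h1 := hbdd _ _ (hX.abs_crossDist_pow_sub_le hg x y x)
    refine tendsto_nhds_unique (hφ g) ?_
    have h2 := h1.neg
    rw [neg_zero] at h2
    refine h2.congr fun n => ?_
    rw [hy]
    simp only [f, crossDist]
    ring
  · have h1 : Tendsto (f γ) U (𝓝 (2 * dist x (γ • x) ^ 2)) := by
      refine (tendsto_const_nhds (x := 2 * dist x (γ • x) ^ 2)).congr' ?_
      -- For `n ≥ 1` the quotient is constant, since `n ^ 2 + 1 - (n - 1) ^ 2 = 2 * n`.
      have hev : ∀ᶠ n : ℕ in U, 1 ≤ n := hU (eventually_ge_atTop 1)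
      filter_upwards [hev] with n hn
      obtain ⟨k, rfl⟩ := Nat.exists_eq_add_of_le' hn
      have e1 := hX.dist_pow_smul_eq hx (k + 1)
      have e2 : dist (γ • x) (γ ^ (k + 1) • x) = k * dist x (γ • x) := by
        rw [pow_succ', mul_smul, dist_smul, hX.dist_pow_smul_eq hx k]
      have hk : ((k + 1 : ℕ) : ℝ) ≠ 0 := by positivity
      simp only [f, crossDist]
      rw [e1, e2, dist_self, dist_comm (γ • x) x, eq_div_iff hk]
      push_cast
      ring
    have h2 := tendsto_nhds_unique (hφ γ) h1
    rw [h0] at h2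
    have h3 : dist x (γ • x) = 0 := by
      have : dist x (γ • x) ^ 2 = 0 := by linarith
      exact pow_eq_zero_iff two_ne_zero |>.1 this
    exact ⟨x, (dist_eq_zero.1 h3).symm⟩

end Action

/-! ### Bases of free groups -/

namespace FreeGroupBasis

theorem closure_range {ι G : Type*} [Group G] (B : FreeGroupBasis ι G) :
    Subgroup.closure (Set.range B) = ⊤ := by
  have h := congrArg (Subgroup.map B.repr.symm.toMonoidHom) (FreeGroup.closure_range_of ι)
  rw [MonoidHom.map_closure, ← Set.range_comp, ← MonoidHom.range_eq_map,
    MonoidHom.range_eq_top.2 B.repr.symm.surjective] at h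
  exact h

/-- A generating family is a basis if some homomorphism to the free group sends its members to
the free generators. -/
noncomputable def ofClosureEqTop {ι G : Type*} [Group G] (b : ι → G) (s : G →* FreeGroup ι)
    (hs : ∀ i, s (b i) = FreeGroup.of i) (hb : Subgroup.closure (Set.range b) = ⊤) :
    FreeGroupBasis ι G :=
  .ofRepr (MonoidHom.toMulEquiv s (FreeGroup.lift b)
    (MonoidHom.eq_of_eqOn_top fun x _ => by
      have : Subgroup.closure (Set.range b) ≤
          ((FreeGroup.lift b).comp s).eqLocus (MonoidHom.id G) := by
        rw [Subgroup.closure_le]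
        rintro _ ⟨i, rfl⟩
        change FreeGroup.lift b (s (b i)) = b i
        simp [hs]
      exact this (hb ▸ Subgroup.mem_top x))
    (FreeGroup.ext_hom _ _ fun i => by simp [hs]))

@[simp]
theorem ofClosureEqTop_apply {ι G : Type*} [Group G] (b : ι → G) (s : G →* FreeGroup ι)
    (hs : ∀ i, s (b i) = FreeGroup.of i) (hb : Subgroup.closure (Set.range b) = ⊤) (i : ι) :
    ofClosureEqTop b s hs hb i = b i := by
  change FreeGroup.lift b (FreeGroup.of i) = b i
  simp

end FreeGroupBasis

theorem FreeGroupBasis.subgroup_le_closure {G ι : Type*} [Group G] {L : Subgroup G}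
    (B : FreeGroupBasis ι L) {t : Set G} (ht : ∀ i, (B i : G) ∈ t) : L ≤ Subgroup.closure t := by
  have h := congrArg (Subgroup.map L.subtype) B.closure_range
  rw [MonoidHom.map_closure, ← Set.range_comp, ← MonoidHom.range_eq_map,
    Subgroup.range_subtype] at h
  rw [← h]
  refine Subgroup.closure_mono ?_
  rintro _ ⟨i, rfl⟩
  exact ht i

theorem tailSubgroup_closure {n : ℕ} {F : Type*} [Group F] (a : FreeGroupBasis (Fin (n + 1)) F)
    (ha : ∀ i : Fin n, a i.succ ∈ tailSubgroup a) :
    Subgroup.closure (Set.range fun i : Fin n => (⟨a i.succ, ha i⟩ : tailSubgroup a)) = ⊤ := by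
  apply Subgroup.map_injective (tailSubgroup a).subtype_injective
  rw [MonoidHom.map_closure, ← Set.range_comp, ← MonoidHom.range_eq_map, Subgroup.range_subtype]
  rfl

theorem mem_tailSubgroup {n : ℕ} {F : Type*} [Group F] (a : FreeGroupBasis (Fin (n + 1)) F)
    (i : Fin n) : a i.succ ∈ tailSubgroup a :=
  Subgroup.subset_closure ⟨i, rfl⟩

/-- The basis `a_1, …, a_n` of `F_n`. -/
noncomputable def tailBasis {n : ℕ} {F : Type*} [Group F] (a : FreeGroupBasis (Fin (n + 1)) F) :
    FreeGroupBasis (Fin n) (tailSubgroup a) :=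
  .ofClosureEqTop (fun i => ⟨a i.succ, mem_tailSubgroup a i⟩)
    ((a.lift (Fin.cons 1 FreeGroup.of)).comp (tailSubgroup a).subtype)
    (fun i => by simp) (tailSubgroup_closure a _)

/-- A basis of `F_n` and `a_0` make up a basis of `F_{n+1}`. -/
theorem exists_basis_option {n : ℕ} {F : Type*} [Group F] (a : FreeGroupBasis (Fin (n + 1)) F)
    {ι : Type*} (B : FreeGroupBasis ι (tailSubgroup a)) :
    ∃ D : FreeGroupBasis (Option ι) F, D none = a 0 ∧ ∀ i, D (some i) = B i := by
  let b : Option ι → F := fun o => o.elim (a 0) fun i => B i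
  let g : tailSubgroup a →* FreeGroup (Option ι) := B.lift fun i => FreeGroup.of (some i)
  let s : F →* FreeGroup (Option ι) :=
    a.lift (Fin.cons (FreeGroup.of none) fun i => g ⟨a i.succ, mem_tailSubgroup a i⟩)
  have hsg : s.comp (tailSubgroup a).subtype = g :=
    (tailBasis a).ext_hom _ _ fun i => by simp [s, tailBasis]
  have hs : ∀ i, s (b i) = FreeGroup.of i := by
    rintro (_ | i)
    · simp [s, b]
    · exact (DFunLike.congr_fun hsg (B i)).trans (by simp [g])
  have hle : tailSubgroup a ≤ Subgroup.closure (Set.range b) :=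
    B.subgroup_le_closure fun i => ⟨some i, rfl⟩
  have hb : Subgroup.closure (Set.range b) = ⊤ := by
    rw [eq_top_iff, ← a.closure_range, Subgroup.closure_le]
    rintro _ ⟨i, rfl⟩
    refine Fin.cases ?_ (fun i => ?_) i
    · exact Subgroup.subset_closure ⟨none, rfl⟩
    · exact hle (mem_tailSubgroup a i)
  exact ⟨.ofClosureEqTop b s hs hb, by simp [b], fun i => by simp [b]⟩

/-- Bases of the factors of an internal free product make up a basis. -/
theorem exists_basis_sum {G : Type*} [Group G] {H K : Subgroup G}
    (hHK : Function.Bijective (Monoid.Coprod.lift H.subtype K.subtype)) {ι κ : Type*}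
    (B : FreeGroupBasis ι H) (C : FreeGroupBasis κ K) :
    ∃ D : FreeGroupBasis (ι ⊕ κ) G, (∀ i, D (Sum.inl i) = B i) ∧ ∀ k, D (Sum.inr k) = C k := by
  let e := MulEquiv.ofBijective _ hHK
  let b : ι ⊕ κ → G := Sum.elim (fun i => B i) fun k => C k
  let s : G →* FreeGroup (ι ⊕ κ) :=
    (Monoid.Coprod.lift (B.lift fun i => FreeGroup.of (Sum.inl i))
      (C.lift fun k => FreeGroup.of (Sum.inr k))).comp e.symm.toMonoidHom
  have heH : ∀ h : H, e.symm h = Monoid.Coprod.inl h := fun h =>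
    e.symm_apply_eq.2 (by simp [e])
  have heK : ∀ k : K, e.symm k = Monoid.Coprod.inr k := fun k =>
    e.symm_apply_eq.2 (by simp [e])
  have hs : ∀ i, s (b i) = FreeGroup.of i := by
    rintro (i | k)
    · simp [s, b, heH]
    · simp [s, b, heK]
  have hb : Subgroup.closure (Set.range b) = ⊤ := by
    rw [eq_top_iff, ← MonoidHom.range_eq_top.2 hHK.surjective, Monoid.Coprod.range_lift,
      Subgroup.range_subtype, Subgroup.range_subtype]
    exact sup_le (B.subgroup_le_closure fun i => ⟨Sum.inl i, rfl⟩)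
      (C.subgroup_le_closure fun k => ⟨Sum.inr k, rfl⟩)
  exact ⟨.ofClosureEqTop b s hs hb, by simp [b], by simp [b]⟩

/-- Count the homomorphisms to the group of order two. -/
theorem FreeGroupBasis.card_eq {G ι κ : Type*} [Group G] [Finite ι] [Finite κ]
    (B : FreeGroupBasis ι G) (C : FreeGroupBasis κ G) : Nat.card ι = Nat.card κ := by
  have h := Nat.card_congr (B.lift.trans C.lift.symm : (ι → Multiplicative (ZMod 2)) ≃
    (κ → Multiplicative (ZMod 2)))
  have h2 : Nat.card (Multiplicative (ZMod 2)) = 2 := Nat.card_zmod 2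
  rw [Nat.card_fun, Nat.card_fun, h2] at h
  exact Nat.pow_right_injective le_rfl h

/-- If `w` lies in a free factor of `F_n` of rank `n - 2`, then `a_0` belongs to a basis of
`F_{n+1}` in which `w` involves neither `a_0` nor two further letters. -/
theorem exists_adapted_basis.{u} {n : ℕ} (hn : 2 ≤ n) {F : Type u} [Group F]
    (a : FreeGroupBasis (Fin (n + 1)) F) (w : tailSubgroup a)
    (hw : ∃ H : Subgroup (tailSubgroup a), IsFreeFactor H ∧ IsFreeOfRank H (n - 2) ∧ w ∈ H) :
    ∃ (ι : Type u) (D : FreeGroupBasis ι F) (x y z : ι), x ≠ y ∧ x ≠ z ∧ y ≠ z ∧ D x = a 0 ∧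
      (w : F) ∈ Subgroup.closure (D '' {x, y, z}ᶜ) ∧
      tailSubgroup a ≤ Subgroup.closure (D '' {x}ᶜ) := by
  obtain ⟨H, ⟨K, hHK⟩, ⟨B⟩, hwH⟩ := hw
  have := a.isFreeGroup
  -- `K` is free by Nielsen–Schreier.
  let C := IsFreeGroup.basis K
  obtain ⟨E, hEl, hEr⟩ := exists_basis_sum hHK B C
  -- At most one generator of `K` would give `F_n` a basis of at most `n - 1` elements. Arguing by
  -- contradiction also supplies the finiteness needed to compare ranks.
  have hnt : Nontrivial (IsFreeGroup.Generators K) := by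
    rw [← not_subsingleton_iff_nontrivial]
    intro hs
    have h := E.card_eq (tailBasis a)
    have h1 : Nat.card (IsFreeGroup.Generators K) ≤ 1 := Finite.card_le_one_iff_subsingleton.2 hs
    rw [Nat.card_sum, Nat.card_fin, Nat.card_fin] at h
    omega
  obtain ⟨y, z, hyz⟩ := hnt.exists_pair_ne
  obtain ⟨D, hD0, hD⟩ := exists_basis_option a E
  refine ⟨_, D, none, some (Sum.inr y), some (Sum.inr z), by simp, by simp, by simpa using hyz,
    hD0, ?_, E.subgroup_le_closure fun i => ⟨some i, by simp, hD i⟩⟩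
  have h : H.map (tailSubgroup a).subtype ≤
      Subgroup.closure (D '' {none, some (Sum.inr y), some (Sum.inr z)}ᶜ) := by
    rw [Subgroup.map_le_iff_le_comap]
    refine (B.subgroup_le_closure fun i => Set.mem_range_self i).trans ?_
    rw [Subgroup.closure_le]
    rintro _ ⟨i, rfl⟩
    exact Subgroup.subset_closure ⟨some (Sum.inl i), by simp, by simp [hD, hEl]⟩
  exact h ⟨w, hwH, rfl⟩

/-! ### Nielsen automorphisms -/

namespace FreeGroupBasis

variable {ι F : Type*} [Group F] (B : FreeGroupBasis ι F)

open Classical in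
/-- The endomorphism that sends the basis element `B i` to `u * B i * v` and fixes the others. -/
noncomputable def nielsenHom (i : ι) (u v : F) : F →* F :=
  B.lift (Function.update B i (u * B i * v))

theorem nielsenHom_self (i : ι) (u v : F) : B.nielsenHom i u v (B i) = u * B i * v := by
  simp [nielsenHom]

theorem nielsenHom_of_ne {i j : ι} (h : j ≠ i) (u v : F) : B.nielsenHom i u v (B j) = B j := by
  simp [nielsenHom, h]

theorem nielsenHom_of_mem (i : ι) (u v : F) {x : F} (hx : x ∈ Subgroup.closure (B '' {i}ᶜ)) :
    B.nielsenHom i u v x = x := by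
  have h : Subgroup.closure (B '' {i}ᶜ) ≤ (B.nielsenHom i u v).eqLocus (MonoidHom.id F) := by
    refine (Subgroup.closure_le _).2 ?_
    rintro _ ⟨j, hj, rfl⟩
    exact B.nielsenHom_of_ne hj u v
  exact h hx

theorem nielsenHom_comp_inv {i : ι} {u v : F} (hu : u ∈ Subgroup.closure (B '' {i}ᶜ))
    (hv : v ∈ Subgroup.closure (B '' {i}ᶜ)) :
    (B.nielsenHom i u v).comp (B.nielsenHom i u⁻¹ v⁻¹) = MonoidHom.id F := by
  refine B.ext_hom _ _ fun j => ?_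
  by_cases hj : j = i
  · subst hj
    simp [nielsenHom_self, nielsenHom_of_mem B j u v hu, nielsenHom_of_mem B j u v hv, mul_assoc]
  · simp [nielsenHom_of_ne B hj]

/-- The automorphism that sends the basis element `B i` to `u * B i * v` and fixes the others,
where `u` and `v` do not involve `B i`. -/
noncomputable def nielsen {i : ι} {u v : F} (hu : u ∈ Subgroup.closure (B '' {i}ᶜ))
    (hv : v ∈ Subgroup.closure (B '' {i}ᶜ)) : MulAut F :=
  MonoidHom.toMulEquiv (B.nielsenHom i u v) (B.nielsenHom i u⁻¹ v⁻¹)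
    (by simpa using B.nielsenHom_comp_inv (inv_mem hu) (inv_mem hv))
    (B.nielsenHom_comp_inv hu hv)

variable {B}

theorem nielsen_self {i : ι} {u v : F} (hu : u ∈ Subgroup.closure (B '' {i}ᶜ))
    (hv : v ∈ Subgroup.closure (B '' {i}ᶜ)) : B.nielsen hu hv (B i) = u * B i * v :=
  B.nielsenHom_self i u v

theorem nielsen_of_mem {i : ι} {u v : F} (hu : u ∈ Subgroup.closure (B '' {i}ᶜ))
    (hv : v ∈ Subgroup.closure (B '' {i}ᶜ)) {x : F} (hx : x ∈ Subgroup.closure (B '' {i}ᶜ)) :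
    B.nielsen hu hv x = x :=
  B.nielsenHom_of_mem i u v hx

theorem nielsen_of_ne {i j : ι} {u v : F} (hu : u ∈ Subgroup.closure (B '' {i}ᶜ))
    (hv : v ∈ Subgroup.closure (B '' {i}ᶜ)) (h : j ≠ i) : B.nielsen hu hv (B j) = B j :=
  B.nielsenHom_of_ne h u v

theorem mulAut_ext {f g : MulAut F} (h : ∀ i, f (B i) = g (B i)) : f = g :=
  MulEquiv.toMonoidHom_injective (B.ext_hom _ _ h)

theorem mem_closure_of_ne {i j : ι} (h : j ≠ i) : B j ∈ Subgroup.closure (B '' {i}ᶜ) :=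
  Subgroup.subset_closure ⟨j, h, rfl⟩

end FreeGroupBasis
open FreeGroupBasis

/-- The right transvection `B i ↦ B i * w`. -/
noncomputable abbrev FreeGroupBasis.nielsenRight {ι F : Type*} [Group F] (B : FreeGroupBasis ι F)
    {i : ι} {w : F} (hw : w ∈ Subgroup.closure (B '' {i}ᶜ)) : MulAut F :=
  B.nielsen (one_mem _) hw

/-- The left transvection `B i ↦ w * B i`. -/
noncomputable abbrev FreeGroupBasis.nielsenLeft {ι F : Type*} [Group F] (B : FreeGroupBasis ι F)
    {i : ι} {w : F} (hw : w ∈ Subgroup.closure (B '' {i}ᶜ)) : MulAut F :=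
  B.nielsen hw (one_mem _)

section Relations

variable {ι F : Type*} [Group F] {B : FreeGroupBasis ι F} {i j : ι} {u v u' v' w : F}

theorem commute_nielsen_of_ne (h : i ≠ j) (hu : u ∈ Subgroup.closure (B '' {i}ᶜ))
    (hv : v ∈ Subgroup.closure (B '' {i}ᶜ)) (hu' : u' ∈ Subgroup.closure (B '' {j}ᶜ))
    (hv' : v' ∈ Subgroup.closure (B '' {j}ᶜ)) (huj : u ∈ Subgroup.closure (B '' {j}ᶜ))
    (hvj : v ∈ Subgroup.closure (B '' {j}ᶜ)) (hui : u' ∈ Subgroup.closure (B '' {i}ᶜ))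
    (hvi : v' ∈ Subgroup.closure (B '' {i}ᶜ)) :
    Commute (B.nielsen hu hv) (B.nielsen hu' hv') := by
  refine mulAut_ext (B := B) fun k => ?_
  by_cases hi : k = i
  · subst hi
    simp [nielsen_self, nielsen_of_ne _ _ h, nielsen_of_mem _ _ huj, nielsen_of_mem _ _ hvj]
  · by_cases hj : k = j
    · subst hj
      simp [nielsen_self, nielsen_of_ne _ _ hi, nielsen_of_mem _ _ hui, nielsen_of_mem _ _ hvi]
    · simp [nielsen_of_ne _ _ hi, nielsen_of_ne _ _ hj]

theorem commute_nielsen_self (hu : u ∈ Subgroup.closure (B '' {i}ᶜ))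
    (hv : v ∈ Subgroup.closure (B '' {i}ᶜ)) (hu' : u' ∈ Subgroup.closure (B '' {i}ᶜ))
    (hv' : v' ∈ Subgroup.closure (B '' {i}ᶜ)) (huu : Commute u u') (hvv : Commute v v') :
    Commute (B.nielsen hu hv) (B.nielsen hu' hv') := by
  refine mulAut_ext (B := B) fun k => ?_
  by_cases hi : k = i
  · subst hi
    simp only [MulAut.mul_apply, nielsen_self, map_mul, nielsen_of_mem _ _ hu,
      nielsen_of_mem _ _ hv, nielsen_of_mem _ _ hu', nielsen_of_mem _ _ hv']
    rw [← mul_assoc, ← mul_assoc, ← mul_assoc, ← mul_assoc, huu.eq, mul_assoc _ v, hvv.eq,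
      mul_assoc _ v']
  · simp [nielsen_of_ne _ _ hi]

/-- This exhibits the transvection of `B i` by `w` as a commutator of that of `B j` by `w` and that
of `B i` by `B j`. -/
theorem nielsenRight_mul_nielsenRight (h : j ≠ i) (hi : w ∈ Subgroup.closure (B '' {i}ᶜ))
    (hj : w ∈ Subgroup.closure (B '' {j}ᶜ)) :
    B.nielsenRight hj * B.nielsenRight (mem_closure_of_ne h) =
      B.nielsenRight (mem_closure_of_ne h) * (B.nielsenRight hi * B.nielsenRight hj) := by
  refine mulAut_ext (B := B) fun k => ?_
  by_cases hki : k = i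
  · subst hki
    simp [nielsen_self, nielsen_of_ne _ _ h.symm, nielsen_of_mem _ _ hi,
      mul_assoc]
  · by_cases hkj : k = j
    · subst hkj
      simp [nielsen_self, nielsen_of_ne _ _ h, nielsen_of_mem _ _ hi]
    · simp [nielsen_of_ne _ _ hki, nielsen_of_ne _ _ hkj]

theorem nielsenLeft_mul_nielsenLeft (h : j ≠ i) (hi : w ∈ Subgroup.closure (B '' {i}ᶜ))
    (hj : w ∈ Subgroup.closure (B '' {j}ᶜ)) :
    B.nielsenLeft hj * B.nielsenLeft (mem_closure_of_ne h) =
      B.nielsenLeft (mem_closure_of_ne h) * (B.nielsenLeft hi * B.nielsenLeft hj) := by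
  refine mulAut_ext (B := B) fun k => ?_
  by_cases hki : k = i
  · subst hki
    simp [nielsen_self, nielsen_of_ne _ _ h.symm, nielsen_of_mem _ _ hi,
      mul_assoc]
  · by_cases hkj : k = j
    · subst hkj
      simp [nielsen_self, nielsen_of_ne _ _ h, nielsen_of_mem _ _ hi]
    · simp [nielsen_of_ne _ _ hki, nielsen_of_ne _ _ hkj]

/-- The partial conjugation `B i ↦ w * B i * w⁻¹`. -/
noncomputable abbrev FreeGroupBasis.nielsenConj {ι F : Type*} [Group F] (B : FreeGroupBasis ι F)
    {i : ι} {w : F} (hw : w ∈ Subgroup.closure (B '' {i}ᶜ)) : MulAut F :=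
  B.nielsen hw (inv_mem hw)

theorem nielsenConj_mul_nielsenRight (hi : w ∈ Subgroup.closure (B '' {i}ᶜ)) :
    B.nielsenConj hi * B.nielsenRight hi = B.nielsenLeft hi := by
  refine mulAut_ext (B := B) fun k => ?_
  by_cases hki : k = i
  · subst hki
    simp [nielsen_self, nielsen_of_mem _ _ hi]
  · simp [nielsen_of_ne _ _ hki]

/-- On the subgroup generated by `B i` and `B j` the product is conjugation by `w`, which the
transvection by `B j` fixes. -/
theorem commute_nielsenConj_nielsenRight (h : j ≠ i) (hi : w ∈ Subgroup.closure (B '' {i}ᶜ))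
    (hj : w ∈ Subgroup.closure (B '' {j}ᶜ)) :
    Commute (B.nielsenConj hi * B.nielsenConj hj) (B.nielsenRight (mem_closure_of_ne h)) := by
  refine mulAut_ext (B := B) fun k => ?_
  by_cases hki : k = i
  · subst hki
    simp [nielsen_self, nielsen_of_ne _ _ h, nielsen_of_ne _ _ h.symm, nielsen_of_mem _ _ hi,
      mul_assoc]
  · by_cases hkj : k = j
    · subst hkj
      simp [nielsen_self, nielsen_of_ne _ _ h, nielsen_of_mem _ _ hi]
    · simp [nielsen_of_ne _ _ hki, nielsen_of_ne _ _ hkj]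

theorem commute_nielsenConj_nielsenLeft (h : j ≠ i) (hi : w ∈ Subgroup.closure (B '' {i}ᶜ))
    (hj : w ∈ Subgroup.closure (B '' {j}ᶜ)) :
    Commute (B.nielsenConj hi * B.nielsenConj hj) (B.nielsenLeft (mem_closure_of_ne h)) := by
  refine mulAut_ext (B := B) fun k => ?_
  by_cases hki : k = i
  · subst hki
    simp [nielsen_self, nielsen_of_ne _ _ h, nielsen_of_ne _ _ h.symm, nielsen_of_mem _ _ hi,
      mul_assoc]
  · by_cases hkj : k = j
    · subst hkj
      simp [nielsen_self, nielsen_of_ne _ _ h, nielsen_of_mem _ _ hi]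
    · simp [nielsen_of_ne _ _ hki, nielsen_of_ne _ _ hkj]

/-- Here `s` is a commutator of elements of the centralizer of `γ`. -/
theorem eq_zero_of_mul_eq {G : Type*} [Group G] {φ : G → ℝ} {γ r s t : G}
    (hφ : ∀ g h, Commute γ g → Commute γ h → φ (g * h) = φ g + φ h) (hr : Commute γ r)
    (hs : Commute γ s) (ht : Commute γ t) (h : r * t = t * (s * r)) : φ s = 0 := by
  have h1 := congrArg φ h
  rw [hφ _ _ hr ht, hφ _ _ ht (hs.mul_right hr), hφ _ _ hs hr] at h1
  linarith

end Relations

/-! ### The fixed point -/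

theorem exists_nielsenRight_smul_eq {ι F : Type*} [Group F] (B : FreeGroupBasis ι F) {x y z : ι}
    (hxy : x ≠ y) (hxz : x ≠ z) (hyz : y ≠ z) {w : F}
    (hw : w ∈ Subgroup.closure (B '' {x, y, z}ᶜ)) (hwx : w ∈ Subgroup.closure (B '' {x}ᶜ))
    {X : Type*} [MetricSpace X] (hX : IsCAT0 X) [MulAction (MulAut F) X]
    (hact : ActsBySemisimpleIsometries (MulAut F) X) :
    ∃ p : X, B.nielsenRight hwx • p = p := by
  have : IsIsometricSMul (MulAut F) X := ⟨fun g => (hact g).1⟩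
  have hmono : ∀ k ∈ ({x, y, z} : Set ι), w ∈ Subgroup.closure (B '' {k}ᶜ) := fun k hk =>
    Subgroup.closure_mono (Set.image_mono
      (Set.compl_subset_compl.2 (Set.singleton_subset_iff.2 hk))) hw
  have hwy : w ∈ Subgroup.closure (B '' {y}ᶜ) := hmono y (by simp)
  have hwz : w ∈ Subgroup.closure (B '' {z}ᶜ) := hmono z (by simp)
  have m : ∀ {i j : ι}, j ≠ i → B j ∈ Subgroup.closure (B '' {i}ᶜ) := mem_closure_of_ne
  have o : ∀ {i : ι}, (1 : F) ∈ Subgroup.closure (B '' {i}ᶜ) := one_mem _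
  set θ := B.nielsenConj hwx * B.nielsenConj hwy with hθ
  have hθ' : θ = B.nielsenConj hwy * B.nielsenConj hwx :=
    commute_nielsen_of_ne hxy hwx (inv_mem hwx) hwy (inv_mem hwy) hwy (inv_mem hwy) hwx
      (inv_mem hwx)
  have hw1 : Commute w⁻¹ w := (Commute.refl w).inv_left
  have cRx : Commute θ (B.nielsenRight hwx) :=
    (commute_nielsen_self hwx (inv_mem hwx) o hwx (.one_right _) hw1).mul_left
      (commute_nielsen_of_ne hxy.symm hwy (inv_mem hwy) o hwx hwx (inv_mem hwx) o hwy)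
  have cLx : Commute θ (B.nielsenLeft hwx) :=
    (commute_nielsen_self hwx (inv_mem hwx) hwx o (.refl _) (.one_right _)).mul_left
      (commute_nielsen_of_ne hxy.symm hwy (inv_mem hwy) hwx o hwx (inv_mem hwx) hwy o)
  have cPL : Commute (B.nielsenConj hwx) (B.nielsenLeft hwy) :=
    commute_nielsen_of_ne hxy hwx (inv_mem hwx) hwy o hwy (inv_mem hwy) hwx o
  have cRy : Commute θ (B.nielsenRight hwy) :=
    (commute_nielsen_of_ne hxy hwx (inv_mem hwx) o hwy hwy (inv_mem hwy) o hwx).mul_left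
      (commute_nielsen_self hwy (inv_mem hwy) o hwy (.one_right _) hw1)
  have cLy : Commute θ (B.nielsenLeft hwy) :=
    cPL.mul_left (commute_nielsen_self hwy (inv_mem hwy) hwy o (.refl _) (.one_right _))
  have hrel : θ * (B.nielsenRight hwy * B.nielsenRight hwx) =
      B.nielsenLeft hwy * B.nielsenLeft hwx := by
    rw [hθ, mul_assoc, ← mul_assoc _ (B.nielsenRight hwy), nielsenConj_mul_nielsenRight,
      ← mul_assoc, cPL.eq, mul_assoc, nielsenConj_mul_nielsenRight]
  have hell : ∃ p : X, θ • p = p := by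
    obtain ⟨φ, hφ, -, hφ0⟩ := hX.exists_additive_on_centralizer θ (hact θ).2
    refine hφ0 ?_
    have hRx := eq_zero_of_mul_eq hφ cRy cRx (commute_nielsenConj_nielsenRight hxy.symm hwx hwy)
      (nielsenRight_mul_nielsenRight hxy.symm hwx hwy)
    have hLx := eq_zero_of_mul_eq hφ cLy cLx (commute_nielsenConj_nielsenLeft hxy.symm hwx hwy)
      (nielsenLeft_mul_nielsenLeft hxy.symm hwx hwy)
    have hRy := eq_zero_of_mul_eq hφ cRx cRy
      (hθ' ▸ commute_nielsenConj_nielsenRight hxy hwy hwx)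
      (nielsenRight_mul_nielsenRight hxy hwy hwx)
    have hLy := eq_zero_of_mul_eq hφ cLx cLy
      (hθ' ▸ commute_nielsenConj_nielsenLeft hxy hwy hwx)
      (nielsenLeft_mul_nielsenLeft hxy hwy hwx)
    have h := congrArg φ hrel
    rw [hφ _ _ (.refl θ) (cRy.mul_right cRx), hφ _ _ cRy cRx, hφ _ _ cLy cLx] at h
    linarith
  obtain ⟨φ, hφ, hφe, hφ0⟩ := hX.exists_additive_on_centralizer (B.nielsenRight hwx)
    (hact (B.nielsenRight hwx)).2
  refine hφ0 ?_
  have dRy : Commute (B.nielsenRight hwx) (B.nielsenRight hwy) :=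
    commute_nielsen_of_ne hxy o hwx o hwy o hwy o hwx
  have dLy : Commute (B.nielsenRight hwx) (B.nielsenLeft hwy) :=
    commute_nielsen_of_ne hxy o hwx hwy o o hwy hwx o
  have dRz : Commute (B.nielsenRight hwx) (B.nielsenRight hwz) :=
    commute_nielsen_of_ne hxz o hwx o hwz o hwz o hwx
  have dLz : Commute (B.nielsenRight hwx) (B.nielsenLeft hwz) :=
    commute_nielsen_of_ne hxz o hwx hwz o o hwz hwx o
  have dLx : Commute (B.nielsenRight hwx) (B.nielsenLeft hwx) :=
    commute_nielsen_self o hwx hwx o (.one_left _) (.one_right _)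
  -- The conjugating element must commute with `R_x`: it multiplies `B y` by `B z`, and `w` does not
  -- involve `B y`.
  have hRy := eq_zero_of_mul_eq hφ dRz dRy
    (commute_nielsen_of_ne hxy o hwx o (m hyz.symm) o hwy o (m hxz.symm))
    (nielsenRight_mul_nielsenRight hyz.symm hwy hwz)
  have hLy := eq_zero_of_mul_eq hφ dLz dLy
    (commute_nielsen_of_ne hxy o hwx (m hyz.symm) o o hwy (m hxz.symm) o)
    (nielsenLeft_mul_nielsenLeft hyz.symm hwy hwz)
  -- Here `B x ↦ B y * B x` serves, as left and right multiplications of `B x` commute.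
  have hLx := eq_zero_of_mul_eq hφ dLy dLx
    (commute_nielsen_self o hwx (m hxy.symm) o (.one_left _) (.one_right _))
    (nielsenLeft_mul_nielsenLeft hxy.symm hwx hwy)
  have hθ0 := hφe θ cRx.symm hell
  have h := congrArg φ hrel
  rw [hφ _ _ cRx.symm (dRy.mul_right (.refl _)), hφ _ _ dRy (.refl _), hφ _ _ dLy dLx] at h
  linarith

theorem proposition3p2 {n : ℕ} (hn : 2 ≤ n) {F : Type*} [Group F]
    (a : FreeGroupBasis (Fin (n + 1)) F) (w : tailSubgroup a)
    (hw : ∃ H : Subgroup (tailSubgroup a), IsFreeFactor H ∧ IsFreeOfRank H (n - 2) ∧ w ∈ H)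
    {X : Type*} [MetricSpace X] [CompleteSpace X] (hX : IsCAT0 X) [MulAction (MulAut F) X]
    (hact : ActsBySemisimpleIsometries (MulAut F) X) :
    ∃ x : X, rightTransvection a w • x = x := by
  obtain ⟨ι, D, x, y, z, hxy, hxz, hyz, hx, hwD, hle⟩ := exists_adapted_basis hn a w hw
  -- The change of basis keeps `a 0` and `F_n`, and these determine `R_w`.
  have h : rightTransvection a w = D.nielsenRight (hle w.2) := by
    refine mulAut_ext (B := a) fun i => ?_
    refine Fin.cases ?_ (fun i => ?_) i
    · refine (transvectionHom_zero a (w : F)).trans ?_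
      rw [← hx, nielsen_self, one_mul]
    · exact (transvectionHom_succ a (w : F) i).trans
        (nielsen_of_mem _ _ (hle (mem_tailSubgroup a i))).symm
  rw [h]
  exact exists_nielsenRight_smul_eq D hxy hxz hyz hwD (hle w.2) hX hact
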